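/- Theorem. Let $m,n\in\mathbb N$, and let $\boldsymbol A=[\underline A,\overline A]$, $\boldsymbol D=[\underline D,\overline D]$ be interval matrices of size $m\times n$ with $\underline D\ge 0$, and $\boldsymbol b=[\underline b,\overline b]$, $\boldsymbol c=[\underline c,\overline c]$ be interval vectors of lengths $m$ and $n$, where intervals, inequalities and absolute values are entrywise. Put $A_c=\frac12(\underline A+\overline A)$, $A_\Delta=\frac12(\overline A-\underline A)$, $c_c=\frac12(\underline c+\overline c)$, $c_\Delta=\frac12(\overline c-\underline c)$. For real data let $f(A,b,c,D)=\sup\{c^Tx : Ax-D|x|\le b\}\in[-\infty,+\infty]$ (with $\sup\emptyset=-\infty$), and set $$\underline f=\inf\{f(A,b,c,D): A\in\boldsymbol A,\ b\in\boldsymbol b,\ c\in\boldsymbol c,\ D\in\boldsymbol D\},$$ $$\underline f^L=\sup\{c_c^Tx-c_\Delta^T|x| : A_cx+(A_\Delta-\underline D)|x|\le\underline b\}.$$ Let $B\subseteq\{1,\dots,m\}$ have $n$ elements, let $N=\{1,\dots,m\}\setminus B$, and let the index $B$ or $N$ denote the restriction to the corresponding rows. Assume nondegenerate $B$-stability: for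 every $A^*$ with $A_c-A_\Delta-\overline D\le A^*\le A_c+A_\Delta+\overline D$, every $b\in\boldsymbol b$ and every $c\in\boldsymbol c$, the matrix $A^*_B$ is nonsingular, $A^*_N(A^*_B)^{-1}b_B\le b_N$, and $(A^*_B)^{-T}c>0$ entrywise. Then the generalized absolute value equation $$(A_c)_Bx+(A_\Delta-\underline D)_B|x|=\underline b_B$$ has a unique solution $x^*\in\mathbb R^n$, and $x^*$ is the unique optimal solution of each of the following five problems: 1. $\max\ c_c^Tx-c_\Delta^T|x|$ subject to $A_cx+(A_\Delta-\underline D)|x|\le\underline b$; 2. $\min\ c_c^Tx-c_\Delta^T|x|$ subject to $(A_c)_Bx+(A_\Delta-\underline D)_B|x|\ge\underline b_B$; 3. $\max\ c_c^Tx-c_\Delta^T|x|$ subject to $(A_c)_Bx+(A_\Delta-\underline D)_B|x|\le\underline b_B$; 4. $\max\ c_c^Tx-c_\Delta^T|x|$ subject to $(A_c)_Bx+(A_\Delta-\underline D)_B|x|=\underline b_B$; 5. $\min\ c_c^Tx-c_\Delta^T|x|$ subject to $(A_c)_Bx+(A_\Delta-\underline D)_B|x|=\underline b_B$. Moreover,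 $$\underline f=\underline f^L=c_c^Tx^*-c_\Delta^T|x^*|.$$ -/

import Mathlib

open Matrix

/-- A real interval matrix, given by entrywise bounds `lower ≤ upper`. -/
structure IntervalMatrix (m n : ℕ) where
  lower : Matrix (Fin m) (Fin n) ℝ
  upper : Matrix (Fin m) (Fin n) ℝ
  lower_le_upper : ∀ i j, lower i j ≤ upper i j

namespace IntervalMatrix

variable {m n : ℕ}

/-- The real matrices lying entrywise between the bounds. -/
def toSet (M : IntervalMatrix m n) : Set (Matrix (Fin m) (Fin n) ℝ) :=
  {X | ∀ i j, M.lower i j ≤ X i j ∧ X i j ≤ M.upper i j}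

/-- The midpoint matrix. -/
noncomputable def mid (M : IntervalMatrix m n) : Matrix (Fin m) (Fin n) ℝ :=
  (1 / 2 : ℝ) • (M.lower + M.upper)

/-- The radius matrix. -/
noncomputable def rad (M : IntervalMatrix m n) : Matrix (Fin m) (Fin n) ℝ :=
  (1 / 2 : ℝ) • (M.upper - M.lower)

end IntervalMatrix

/-- A real interval vector, given by entrywise bounds `lower ≤ upper`. -/
structure IntervalVector (k : ℕ) where
  lower : Fin k → ℝ
  upper : Fin k → ℝ
  lower_le_upper : lower ≤ upper

namespace IntervalVector

variable {k : ℕ}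

/-- The real vectors lying entrywise between the bounds. -/
def toSet (v : IntervalVector k) : Set (Fin k → ℝ) := Set.Icc v.lower v.upper

/-- The midpoint vector. -/
noncomputable def mid (v : IntervalVector k) : Fin k → ℝ := (1 / 2 : ℝ) • (v.lower + v.upper)

/-- The radius vector. -/
noncomputable def rad (v : IntervalVector k) : Fin k → ℝ := (1 / 2 : ℝ) • (v.upper - v.lower)

end IntervalVector

/-- `A_B`: the rows of `A` indexed by `B`. The index set is given by an injective
enumeration `B` of its `n` elements, so that `A_B` is a square matrix. -/
def basicRows {m n : ℕ} (B : Fin n ↪ Fin m) (A : Matrix (Fin m) (Fin n) ℝ) :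
    Matrix (Fin n) (Fin n) ℝ :=
  A.submatrix B id

/-- `A_N`: the rows of `A` whose index is not in `B`. -/
def nonbasicRows {m n : ℕ} (B : Fin n ↪ Fin m) (A : Matrix (Fin m) (Fin n) ℝ) :
    Matrix {i : Fin m // i ∉ Set.range B} (Fin n) ℝ :=
  A.submatrix Subtype.val id

/-- `b_B`: the entries of `b` indexed by `B`. -/
def basicPart {m n : ℕ} (B : Fin n ↪ Fin m) (b : Fin m → ℝ) : Fin n → ℝ :=
  fun i => b (B i)

/-- `b_N`: the entries of `b` whose index is not in `B`. -/
def nonbasicPart {m n : ℕ} (B : Fin n ↪ Fin m) (b : Fin m → ℝ) :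
    {i : Fin m // i ∉ Set.range B} → ℝ :=
  fun i => b i.val

/-- `B` is a nondegenerate optimal basis of the linear program `max cᵀx s.t. A x ≤ b`:
`A_B` is nonsingular, `A_N A_B⁻¹ b_B ≤ b_N`, and `A_B⁻ᵀ c > 0` entrywise. -/
def IsNondegenerateOptimalBasis {m n : ℕ} (A : Matrix (Fin m) (Fin n) ℝ) (b : Fin m → ℝ)
    (c : Fin n → ℝ) (B : Fin n ↪ Fin m) : Prop :=
  IsUnit (basicRows B A) ∧
    (nonbasicRows B A * (basicRows B A)⁻¹) *ᵥ basicPart B b ≤ nonbasicPart B b ∧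
    ∀ i, 0 < (((basicRows B A)⁻¹)ᵀ *ᵥ c) i

/-- The feasible set `{x | A x - D |x| ≤ b}` of an absolute value linear program. -/
def avlpFeasible {m n : ℕ} (A : Matrix (Fin m) (Fin n) ℝ) (b : Fin m → ℝ)
    (D : Matrix (Fin m) (Fin n) ℝ) : Set (Fin n → ℝ) :=
  {x | A *ᵥ x - D *ᵥ |x| ≤ b}

/-- The optimal value of `max cᵀx s.t. A x - D |x| ≤ b`, as an extended real number:
`⊥` if the problem is infeasible and `⊤` if it is unbounded. -/
noncomputable def avlpValue {m n : ℕ} (A : Matrix (Fin m) (Fin n) ℝ) (b : Fin m → ℝ)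
    (c : Fin n → ℝ) (D : Matrix (Fin m) (Fin n) ℝ) : EReal :=
  ⨆ x ∈ avlpFeasible A b D, ((c ⬝ᵥ x : ℝ) : EReal)

/-- The optimal solutions of `max g(x) s.t. x ∈ F`. -/
def maximizers {n : ℕ} (g : (Fin n → ℝ) → ℝ) (F : Set (Fin n → ℝ)) : Set (Fin n → ℝ) :=
  {x | x ∈ F ∧ ∀ y ∈ F, g y ≤ g x}

/-- The optimal solutions of `min g(x) s.t. x ∈ F`. -/
def minimizers {n : ℕ} (g : (Fin n → ℝ) → ℝ) (F : Set (Fin n → ℝ)) : Set (Fin n → ℝ) :=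
  {x | x ∈ F ∧ ∀ y ∈ F, g x ≤ g y}

/-- The data of an interval absolute value linear program
`max cᵀx s.t. A x - D |x| ≤ b`, with a nonnegative lower bound of the interval matrix `D`. -/
structure IntervalAVLP (m n : ℕ) where
  A : IntervalMatrix m n
  b : IntervalVector m
  c : IntervalVector n
  D : IntervalMatrix m n
  D_nonneg : ∀ i j, 0 ≤ D.lower i j

namespace IntervalAVLP

variable {m n : ℕ}

/-- The worst case optimal value: the infimum of the optimal values of all realizations. -/
noncomputable def worstValue (P : IntervalAVLP m n) : EReal :=
  ⨅ A ∈ P.A.toSet, ⨅ b ∈ P.b.toSet, ⨅ c ∈ P.c.toSet, ⨅ D ∈ P.D.toSet, avlpValue A b c D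

/-- The objective function `c_cᵀx - c_Δᵀ|x|`. -/
noncomputable def worstObjective (P : IntervalAVLP m n) (x : Fin n → ℝ) : ℝ :=
  P.c.mid ⬝ᵥ x - P.c.rad ⬝ᵥ |x|

/-- The feasible set `A_c x + (A_Δ - D.lower) |x| ≤ b.lower` of the lower bound problem. -/
def lowerBoundFeasible (P : IntervalAVLP m n) : Set (Fin n → ℝ) :=
  {x | P.A.mid *ᵥ x + (P.A.rad - P.D.lower) *ᵥ |x| ≤ P.b.lower}

/-- The lower bound `f^L`, the optimal value of
`max c_cᵀx - c_Δᵀ|x| s.t. A_c x + (A_Δ - D.lower) |x| ≤ b.lower`. -/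
noncomputable def lowerBound (P : IntervalAVLP m n) : EReal :=
  ⨆ x ∈ P.lowerBoundFeasible, ((P.worstObjective x : ℝ) : EReal)

/-- The map `x ↦ (A_c)_B x + (A_Δ - D.lower)_B |x|`. -/
noncomputable def basicMap (P : IntervalAVLP m n) (B : Fin n ↪ Fin m) (x : Fin n → ℝ) :
    Fin n → ℝ :=
  basicRows B P.A.mid *ᵥ x + basicRows B (P.A.rad - P.D.lower) *ᵥ |x|

/-- Points with `(A_c)_B x + (A_Δ - D.lower)_B |x| ≤ (b.lower)_B`. -/
def basicLe (P : IntervalAVLP m n) (B : Fin n ↪ Fin m) : Set (Fin n → ℝ) :=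
  {x | P.basicMap B x ≤ basicPart B P.b.lower}

/-- Points with `(A_c)_B x + (A_Δ - D.lower)_B |x| ≥ (b.lower)_B`. -/
def basicGe (P : IntervalAVLP m n) (B : Fin n ↪ Fin m) : Set (Fin n → ℝ) :=
  {x | basicPart B P.b.lower ≤ P.basicMap B x}

/-- Solutions of the generalized absolute value equation
`(A_c)_B x + (A_Δ - D.lower)_B |x| = (b.lower)_B`. -/
def basicEq (P : IntervalAVLP m n) (B : Fin n ↪ Fin m) : Set (Fin n → ℝ) :=
  {x | P.basicMap B x = basicPart B P.b.lower}

/-- The interval matrix `A* = [A_c - A_Δ - D.upper, A_c + A_Δ + D.upper]`. -/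
noncomputable def relaxedMatrix (P : IntervalAVLP m n) : IntervalMatrix m n where
  lower := P.A.mid - P.A.rad - P.D.upper
  upper := P.A.mid + P.A.rad + P.D.upper
  lower_le_upper i j := by
    have hA := P.A.lower_le_upper i j
    have hD := P.D_nonneg i j
    have hD' := P.D.lower_le_upper i j
    simp only [IntervalMatrix.rad, IntervalMatrix.mid, Matrix.sub_apply, Matrix.add_apply,
      Matrix.smul_apply, smul_eq_mul]
    linarith

/-- Nondegenerate `B`-stability: `B` is a nondegenerate optimal basis of every realization
of the interval linear program `max cᵀx s.t. A* x ≤ b`. -/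
def IsNondegenerateBStable (P : IntervalAVLP m n) (B : Fin n ↪ Fin m) : Prop :=
  ∀ A ∈ P.relaxedMatrix.toSet, ∀ b ∈ P.b.toSet, ∀ c ∈ P.c.toSet,
    IsNondegenerateOptimalBasis A b c B

end IntervalAVLP

/-!
The proof rests on the fact that a difference of absolute values is an interval multiple of a
difference: `|a| - |b| = t * (a - b)` with `|t| ≤ 1`. Applied in each coordinate, it linearizes the
difference of two values of the map `F x = (A_c)_B x + (A_Δ - D.lower)_B |x|` and of the objective
`g x = c_cᵀ x - c_Δᵀ |x|`, with one and the same diagonal matrix: `F x - F y = A*_B (x - y)` and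
`g x - g y = cᵀ (x - y)`, where `A*` is a realization of the relaxed interval matrix and `c` one of
the interval objective. Hence `g x - g y = wᵀ (F x - F y)` with `w = A*_B⁻ᵀ c > 0`, so that `g` is a
strictly increasing function of `F`, and `F` is injective (`eq_of_basicMap_le`). All five
optimization problems then have the solution of `F x = b.lower_B` as their unique optimum, once it
exists.

Existence is proved by replacing linear terms with absolute values one coordinate at a time
(`exists_solution_of_regular`). Given solutions `p`, `q` of the equations in which the term `|x k|`
is replaced by `x k` and by `-x k`, respectively, `p` solves the original equation if `p k ≥ 0`, and
`q` does if `q k ≤ 0`. Otherwise `p k < 0 < q k`, so `p k + q k` is again an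
interval multiple of `p k - q k`, and nonsingularity of the realizations forces `p = q`, which is absurd.

For the worst case value, the solution `x` is feasible for every realization with objective at least
`g x`. The realization with `A = A_c + A_Δ diag (sign x)`, `c = c_c - c_Δ * sign x` and the lower
bounds of `b` and `D` attains this value, by the same linearization applied to `A x - D |x|`.
-/

/-! ### Interval slopes of the absolute value -/

lemma exists_abs_le_one_mul_sub {a b u v : ℝ} (h : |u - v| ≤ |a - b|) :
    ∃ t : ℝ, |t| ≤ 1 ∧ u - v = t * (a - b) := by
  by_cases hab : a - b = 0
  · refine ⟨0, by simp, ?_⟩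
    rw [hab, abs_zero] at h
    rw [abs_nonpos_iff.mp h, zero_mul]
  · refine ⟨(u - v) / (a - b), ?_, by field_simp⟩
    rw [abs_div]
    exact div_le_one_of_le₀ h (abs_nonneg _)

lemma exists_slope_abs_sub {n : ℕ} (x y : Fin n → ℝ) :
    ∃ t : Fin n → ℝ, (∀ j, |t j| ≤ 1) ∧ |x| - |y| = t * (x - y) := by
  choose t ht h using fun j => exists_abs_le_one_mul_sub (abs_abs_sub_abs_le_abs_sub (x j) (y j))
  exact ⟨t, ht, funext h⟩

lemma exists_sign_mul_eq_abs {n : ℕ} (x : Fin n → ℝ) :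
    ∃ s : Fin n → ℝ, (∀ j, |s j| ≤ 1) ∧ |x| = s * x := by
  obtain ⟨s, hs, h⟩ := exists_slope_abs_sub x 0
  exact ⟨s, hs, by simpa using h⟩

lemma add_mul_diagonal_mulVec {k n : ℕ} (A M : Matrix (Fin k) (Fin n) ℝ) (t x : Fin n → ℝ) :
    (A + M * diagonal t) *ᵥ x = A *ᵥ x + M *ᵥ (t * x) := by
  rw [add_mulVec, ← mulVec_mulVec]
  congr 2
  ext j
  simp [mulVec_diagonal]

/-! ### Solvability of generalized absolute value equations -/

/-- The coordinates in `S` carry an absolute value, the others a fixed slope in `[-1, 1]`; the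
induction on `S` starts from a nonsingular linear system. The hypothesis is required for all slopes
in `[-1, 1]`, since the difference of two solutions is governed by an intermediate one. -/
lemma exists_solution_of_regular {n : ℕ} (A M : Matrix (Fin n) (Fin n) ℝ)
    (hreg : ∀ t : Fin n → ℝ, (∀ j, |t j| ≤ 1) → IsUnit (A + M * diagonal t)) (b : Fin n → ℝ)
    (S : Finset (Fin n)) : ∀ t : Fin n → ℝ, (∀ j, |t j| ≤ 1) →
      ∃ x : Fin n → ℝ, A *ᵥ x + M *ᵥ (fun j => if j ∈ S then |x j| else t j * x j) = b := by
  induction S using Finset.induction_on with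
  | empty =>
    intro t ht
    obtain ⟨x, hx⟩ := (mulVec_surjective_iff_isUnit.mpr (hreg t ht)) b
    refine ⟨x, ?_⟩
    rw [← hx, add_mul_diagonal_mulVec]
    simp only [Finset.notMem_empty, if_false]
    rfl
  | insert k S hk ih =>
    intro t ht
    have hupd : ∀ r : ℝ, |r| ≤ 1 → ∀ j, |Function.update t k r j| ≤ 1 := by
      intro r hr j
      by_cases hj : j = k
      · subst hj; simpa using hr
      · simpa [hj] using ht j
    -- A solution with slope `r` at `k` works as soon as `r * x k = |x k|`.
    have hdone : ∀ (r : ℝ) (x : Fin n → ℝ), r * x k = |x k| →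
        (fun j => if j ∈ insert k S then |x j| else t j * x j) =
          fun j => if j ∈ S then |x j| else Function.update t k r j * x j := by
      intro r x hr
      funext j
      by_cases hj : j = k
      · subst hj; simp [hk, hr]
      · simp [hj]
    obtain ⟨p, hp⟩ := ih _ (hupd 1 (by simp))
    obtain ⟨q, hq⟩ := ih _ (hupd (-1) (by simp))
    by_cases hpk : 0 ≤ p k
    · exact ⟨p, by rw [hdone 1 p (by rw [abs_of_nonneg hpk, one_mul]), hp]⟩
    by_cases hqk : q k ≤ 0
    · exact ⟨q, by rw [hdone (-1) q (by rw [abs_of_nonpos hqk, neg_one_mul]), hq]⟩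
    exfalso
    push Not at hpk hqk
    have hslope : ∀ j, ∃ r : ℝ, |r| ≤ 1 ∧
        (if j ∈ S then |p j| else Function.update t k 1 j * p j) -
          (if j ∈ S then |q j| else Function.update t k (-1) j * q j) = r * (p j - q j) := by
      intro j
      by_cases hjS : j ∈ S
      · simp only [hjS, if_true]
        exact exists_abs_le_one_mul_sub (abs_abs_sub_abs_le_abs_sub _ _)
      · by_cases hj : j = k
        · subst hj
          simp only [hjS, if_false, Function.update_self]
          apply exists_abs_le_one_mul_sub
          -- The opposite signs of `p j` and `q j` give `|p j + q j| ≤ |p j - q j|`.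
          rw [abs_of_neg (show p j - q j < 0 by linarith)]
          exact abs_le.mpr ⟨by linarith, by linarith⟩
        · exact ⟨t j, ht j, by simp [hjS, hj, mul_sub]⟩
    choose r hr hrpq using hslope
    have hzero : (A + M * diagonal r) *ᵥ (p - q) = (A + M * diagonal r) *ᵥ 0 := by
      rw [add_mul_diagonal_mulVec, ← show _ = r * (p - q) from funext hrpq, mulVec_zero,
        ← Pi.sub_def, mulVec_sub, mulVec_sub, sub_add_sub_comm, hp, hq, sub_self]
    have hpq := congrFun (mulVec_injective_of_isUnit (hreg r hr) hzero) k
    simp only [Pi.sub_apply, Pi.zero_apply] at hpq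
    linarith

/-! ### Realizations of the interval data -/

namespace IntervalVector

variable {k : ℕ}

lemma rad_nonneg (v : IntervalVector k) (i : Fin k) : 0 ≤ v.rad i := by
  have := v.lower_le_upper i
  simp only [rad, Pi.smul_apply, Pi.sub_apply, smul_eq_mul]
  linarith

lemma mem_toSet_iff_abs (v : IntervalVector k) (x : Fin k → ℝ) :
    x ∈ v.toSet ↔ ∀ i, |x i - v.mid i| ≤ v.rad i := by
  simp only [toSet, Set.mem_Icc, Pi.le_def, ← forall_and, abs_le, mid, rad, Pi.smul_apply,
    Pi.sub_apply, Pi.add_apply, smul_eq_mul]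
  refine forall_congr' fun i => ⟨fun h => ⟨?_, ?_⟩, fun h => ⟨?_, ?_⟩⟩ <;> linarith [h.1, h.2]

lemma mid_sub_rad_mul_mem (v : IntervalVector k) {t : Fin k → ℝ} (ht : ∀ i, |t i| ≤ 1) :
    v.mid - v.rad * t ∈ v.toSet := by
  rw [mem_toSet_iff_abs]
  intro i
  have := mul_le_of_le_one_right (v.rad_nonneg i) (ht i)
  simpa [abs_mul, abs_of_nonneg (v.rad_nonneg i)] using this

end IntervalVector

namespace IntervalMatrix

variable {m n : ℕ}

lemma rad_nonneg (M : IntervalMatrix m n) (i : Fin m) (j : Fin n) : 0 ≤ M.rad i j := by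
  have := M.lower_le_upper i j
  simp only [rad, Matrix.smul_apply, Matrix.sub_apply, smul_eq_mul]
  linarith

lemma mem_toSet_iff_abs (M : IntervalMatrix m n) (X : Matrix (Fin m) (Fin n) ℝ) :
    X ∈ M.toSet ↔ ∀ i j, |X i j - M.mid i j| ≤ M.rad i j := by
  simp only [toSet, Set.mem_ofPred_eq, abs_le, mid, rad, Matrix.smul_apply,
    Matrix.sub_apply, Matrix.add_apply, smul_eq_mul]
  refine forall_congr' fun i => forall_congr' fun j => ⟨fun h => ⟨?_, ?_⟩, fun h => ⟨?_, ?_⟩⟩ <;>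
    linarith [h.1, h.2]

lemma mid_add_rad_mul_diagonal_mem (M : IntervalMatrix m n) {t : Fin n → ℝ}
    (ht : ∀ j, |t j| ≤ 1) : M.mid + M.rad * diagonal t ∈ M.toSet := by
  rw [mem_toSet_iff_abs]
  intro i j
  have := mul_le_of_le_one_right (M.rad_nonneg i j) (ht j)
  simpa [abs_mul, abs_of_nonneg (M.rad_nonneg i j)] using this

end IntervalMatrix

namespace IntervalAVLP

variable {m n : ℕ}

/-- An absolute value term of any `D` contributes to the coefficients at most `D.upper`, which is
how the relaxed interval matrix is obtained. -/
lemma sub_mul_diagonal_mem_relaxedMatrix (P : IntervalAVLP m n) {A D : Matrix (Fin m) (Fin n) ℝ}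
    (hA : A ∈ P.A.toSet) (hD : D ∈ P.D.toSet) {t : Fin n → ℝ} (ht : ∀ j, |t j| ≤ 1) :
    A - D * diagonal t ∈ P.relaxedMatrix.toSet := by
  intro i j
  have hA' := abs_le.mp ((P.A.mem_toSet_iff_abs A).mp hA i j)
  have hD0 : 0 ≤ D i j := (P.D_nonneg i j).trans (hD i j).1
  have hDt : |D i j * t j| ≤ D i j := by
    rw [abs_mul, abs_of_nonneg hD0]
    exact mul_le_of_le_one_right hD0 (ht j)
  have hDt' := abs_le.mp hDt
  have hDu := (hD i j).2
  simp only [relaxedMatrix, Matrix.sub_apply, Matrix.add_apply, mul_diagonal]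
  constructor <;> linarith [hA'.1, hA'.2, hDt'.1, hDt'.2]

lemma mid_add_mul_diagonal_mem_relaxedMatrix (P : IntervalAVLP m n) {t : Fin n → ℝ}
    (ht : ∀ j, |t j| ≤ 1) :
    P.A.mid + (P.A.rad - P.D.lower) * diagonal t ∈ P.relaxedMatrix.toSet := by
  rw [Matrix.sub_mul, ← add_sub_assoc]
  exact P.sub_mul_diagonal_mem_relaxedMatrix (P.A.mid_add_rad_mul_diagonal_mem ht)
    (fun i j => ⟨le_rfl, P.D.lower_le_upper i j⟩) ht

lemma basicRows_mulVec {B : Fin n ↪ Fin m} (A : Matrix (Fin m) (Fin n) ℝ) (x : Fin n → ℝ) :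
    basicRows B A *ᵥ x = basicPart B (A *ᵥ x) := rfl

lemma worstObjective_sub_eq (P : IntervalAVLP m n) {x y t : Fin n → ℝ}
    (h : |x| - |y| = t * (x - y)) :
    P.worstObjective x - P.worstObjective y = (P.c.mid - P.c.rad * t) ⬝ᵥ (x - y) := by
  have hmul : (P.c.rad * t) ⬝ᵥ (x - y) = P.c.rad ⬝ᵥ (t * (x - y)) := by
    simp only [dotProduct, Pi.mul_apply, mul_assoc]
  rw [sub_dotProduct, hmul, ← h, dotProduct_sub, dotProduct_sub, worstObjective, worstObjective]
  ring

lemma basicMap_sub_eq (P : IntervalAVLP m n) (B : Fin n ↪ Fin m) {x y t : Fin n → ℝ}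
    (h : |x| - |y| = t * (x - y)) :
    P.basicMap B x - P.basicMap B y =
      basicRows B (P.A.mid + (P.A.rad - P.D.lower) * diagonal t) *ᵥ (x - y) := by
  rw [basicRows_mulVec, add_mul_diagonal_mulVec, ← h, mulVec_sub, mulVec_sub]
  ext i
  simp only [basicMap, basicRows_mulVec, basicPart, Pi.add_apply, Pi.sub_apply]
  ring

/-! ### Monotonicity of the objective in the basic map -/

variable {P : IntervalAVLP m n} {B : Fin n ↪ Fin m}

/-- The objective is the combination of the basic rows with the positive dual solution
`A_B⁻ᵀ c`. -/
lemma IsNondegenerateBStable.dotProduct_nonpos (hB : P.IsNondegenerateBStable B)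
    {A : Matrix (Fin m) (Fin n) ℝ} (hA : A ∈ P.relaxedMatrix.toSet) {c : Fin n → ℝ}
    (hc : c ∈ P.c.toSet) {d : Fin n → ℝ} (hd : basicRows B A *ᵥ d ≤ 0) :
    c ⬝ᵥ d ≤ 0 ∧ (0 ≤ c ⬝ᵥ d → d = 0) := by
  obtain ⟨hu, -, hw⟩ := hB A hA P.b.lower ⟨le_rfl, P.b.lower_le_upper⟩ c hc
  have hinv : (basicRows B A)⁻¹ *ᵥ (basicRows B A *ᵥ d) = d := by
    rw [mulVec_mulVec, nonsing_inv_mul _ ((isUnit_iff_isUnit_det _).mp hu), one_mulVec]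
  have hcd : c ⬝ᵥ d = ((basicRows B A)⁻¹ᵀ *ᵥ c) ⬝ᵥ (basicRows B A *ᵥ d) := by
    rw [mulVec_transpose, ← dotProduct_mulVec, hinv]
  have hterm : ∀ i ∈ Finset.univ,
      ((basicRows B A)⁻¹ᵀ *ᵥ c) i * (basicRows B A *ᵥ d) i ≤ 0 :=
    fun i _ => mul_nonpos_of_nonneg_of_nonpos (hw i).le (hd i)
  have hle : c ⬝ᵥ d ≤ 0 := hcd ▸ Finset.sum_nonpos hterm
  refine ⟨hle, fun h0 => ?_⟩
  have hsum := (Finset.sum_eq_zero_iff_of_nonpos hterm).mp (hcd.symm.trans (le_antisymm hle h0))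
  have hzero : basicRows B A *ᵥ d = 0 :=
    funext fun i => (mul_eq_zero.mp (hsum i (Finset.mem_univ i))).resolve_left (hw i).ne'
  rw [← hinv, hzero, mulVec_zero]

lemma IsNondegenerateBStable.worstObjective_le (hB : P.IsNondegenerateBStable B)
    {x y : Fin n → ℝ} (h : P.basicMap B x ≤ P.basicMap B y) :
    P.worstObjective x ≤ P.worstObjective y := by
  obtain ⟨t, ht, hxy⟩ := exists_slope_abs_sub x y
  have := hB.dotProduct_nonpos (P.mid_add_mul_diagonal_mem_relaxedMatrix ht)
    (P.c.mid_sub_rad_mul_mem ht) (d := x - y)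
    (by rw [← P.basicMap_sub_eq B hxy]; exact sub_nonpos.mpr h)
  rw [← P.worstObjective_sub_eq hxy] at this
  exact sub_nonpos.mp this.1

lemma IsNondegenerateBStable.eq_of_basicMap_le (hB : P.IsNondegenerateBStable B)
    {x y : Fin n → ℝ} (h : P.basicMap B x ≤ P.basicMap B y)
    (hg : P.worstObjective y ≤ P.worstObjective x) : x = y := by
  obtain ⟨t, ht, hxy⟩ := exists_slope_abs_sub x y
  have := hB.dotProduct_nonpos (P.mid_add_mul_diagonal_mem_relaxedMatrix ht)
    (P.c.mid_sub_rad_mul_mem ht) (d := x - y)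
    (by rw [← P.basicMap_sub_eq B hxy]; exact sub_nonpos.mpr h)
  rw [← P.worstObjective_sub_eq hxy] at this
  exact sub_eq_zero.mp (this.2 (sub_nonneg.mpr hg))

lemma IsNondegenerateBStable.basicEq_nonempty (hB : P.IsNondegenerateBStable B) :
    (P.basicEq B).Nonempty := by
  have hmid : P.c.mid ∈ P.c.toSet := by
    simpa using P.c.mid_sub_rad_mul_mem (t := 0) (by simp)
  obtain ⟨x, hx⟩ := exists_solution_of_regular (basicRows B P.A.mid)
    (basicRows B (P.A.rad - P.D.lower))
    (fun t ht => (hB _ (P.mid_add_mul_diagonal_mem_relaxedMatrix ht) P.b.lower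
      ⟨le_rfl, P.b.lower_le_upper⟩ _ hmid).1)
    (basicPart B P.b.lower) Finset.univ 0 (by simp)
  refine ⟨x, ?_⟩
  simp only [Finset.mem_univ, if_true] at hx
  exact hx

/-- The nonbasic constraints hold at the solution because of the primal feasibility condition of
the basis, taken for the realization that fixes the signs of the solution. -/
lemma IsNondegenerateBStable.basicEq_subset_lowerBoundFeasible (hB : P.IsNondegenerateBStable B) :
    P.basicEq B ⊆ P.lowerBoundFeasible := by
  intro x hx
  obtain ⟨s, hs, hsx⟩ := exists_sign_mul_eq_abs x
  set A := P.A.mid + (P.A.rad - P.D.lower) * diagonal s with hAdef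
  have hAx : A *ᵥ x = P.A.mid *ᵥ x + (P.A.rad - P.D.lower) *ᵥ |x| := by
    rw [hAdef, add_mul_diagonal_mulVec, hsx]
  have hmid : P.c.mid ∈ P.c.toSet := by
    simpa using P.c.mid_sub_rad_mul_mem (t := 0) (by simp)
  obtain ⟨hu, hN, -⟩ := hB A (P.mid_add_mul_diagonal_mem_relaxedMatrix hs) P.b.lower
    ⟨le_rfl, P.b.lower_le_upper⟩ _ hmid
  have hbasic : basicRows B A *ᵥ x = basicPart B P.b.lower := by
    rw [basicRows_mulVec, hAx]
    exact hx
  rw [← hbasic, mulVec_mulVec, Matrix.mul_assoc,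
    nonsing_inv_mul _ ((isUnit_iff_isUnit_det _).mp hu), Matrix.mul_one] at hN
  change P.A.mid *ᵥ x + (P.A.rad - P.D.lower) *ᵥ |x| ≤ P.b.lower
  rw [← hAx]
  intro i
  by_cases hi : i ∈ Set.range B
  · obtain ⟨k, rfl⟩ := hi
    exact (congrFun hbasic k).le
  · exact hN ⟨i, hi⟩

lemma lowerBoundFeasible_subset_basicLe : P.lowerBoundFeasible ⊆ P.basicLe B :=
  fun _ hx i => hx (B i)

/-! ### The worst case value -/

lemma lowerBoundFeasible_subset_avlpFeasible {A D : Matrix (Fin m) (Fin n) ℝ} {b : Fin m → ℝ}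
    (hA : A ∈ P.A.toSet) (hb : b ∈ P.b.toSet) (hD : D ∈ P.D.toSet) :
    P.lowerBoundFeasible ⊆ avlpFeasible A b D := by
  intro x hx i
  refine le_trans ?_ ((hx i).trans (hb.1 i))
  simp only [Pi.sub_apply, Pi.add_apply, mulVec, dotProduct, ← Finset.sum_sub_distrib,
    ← Finset.sum_add_distrib, Pi.abs_apply, Matrix.sub_apply]
  refine Finset.sum_le_sum fun j _ => ?_
  have h1 : (A i j - P.A.mid i j) * x j ≤ P.A.rad i j * |x j| := by
    refine (le_abs_self _).trans ?_
    rw [abs_mul]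
    exact mul_le_mul_of_nonneg_right ((P.A.mem_toSet_iff_abs A).mp hA i j) (abs_nonneg _)
  have h2 := mul_le_mul_of_nonneg_right (hD i j).1 (abs_nonneg (x j))
  linarith

lemma worstObjective_le_dotProduct {c : Fin n → ℝ} (hc : c ∈ P.c.toSet) (x : Fin n → ℝ) :
    P.worstObjective x ≤ c ⬝ᵥ x := by
  simp only [worstObjective, dotProduct, ← Finset.sum_sub_distrib, Pi.abs_apply]
  refine Finset.sum_le_sum fun j _ => ?_
  have h : -((c j - P.c.mid j) * x j) ≤ P.c.rad j * |x j| := by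
    refine (neg_le_abs _).trans ?_
    rw [abs_mul]
    exact mul_le_mul_of_nonneg_right ((P.c.mem_toSet_iff_abs c).mp hc j) (abs_nonneg _)
  linarith

/-- A point feasible for the lower bound problem is feasible for every realization, with an objective
value at least as large. -/
lemma lowerBound_le_worstValue : P.lowerBound ≤ P.worstValue :=
  le_iInf₂ fun _ hA => le_iInf₂ fun _ hb => le_iInf₂ fun _ hc => le_iInf₂ fun _ hD =>
    iSup₂_le fun x hx => (EReal.coe_le_coe_iff.mpr (worstObjective_le_dotProduct hc x)).trans
      (le_iSup₂_of_le x (lowerBoundFeasible_subset_avlpFeasible hA hb hD hx) le_rfl)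

lemma IsNondegenerateBStable.worstValue_le (hB : P.IsNondegenerateBStable B) {x : Fin n → ℝ}
    (hx : x ∈ P.basicEq B) : P.worstValue ≤ ((P.worstObjective x : ℝ) : EReal) := by
  obtain ⟨s, hs, hsx⟩ := exists_sign_mul_eq_abs x
  have hA := P.A.mid_add_rad_mul_diagonal_mem hs
  have hc := P.c.mid_sub_rad_mul_mem hs
  have hD : P.D.lower ∈ P.D.toSet := fun i j => ⟨le_rfl, P.D.lower_le_upper i j⟩
  refine iInf₂_le_of_le _ hA (iInf₂_le_of_le P.b.lower ⟨le_rfl, P.b.lower_le_upper⟩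
    (iInf₂_le_of_le _ hc (iInf₂_le_of_le _ hD (iSup₂_le fun y hy => ?_))))
  rw [EReal.coe_le_coe_iff]
  have hcx : P.worstObjective x = (P.c.mid - P.c.rad * s) ⬝ᵥ x := by
    have := P.worstObjective_sub_eq (x := x) (y := 0) (t := s) (by simpa using hsx)
    simpa [worstObjective] using this
  rw [hcx, ← sub_nonpos, ← dotProduct_sub]
  obtain ⟨t, ht, hyx⟩ := exists_slope_abs_sub y x
  refine (hB.dotProduct_nonpos (P.sub_mul_diagonal_mem_relaxedMatrix hA hD ht) hc ?_).1
  have hAx : (P.A.mid + P.A.rad * diagonal s) *ᵥ x - P.D.lower *ᵥ |x|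
      = P.A.mid *ᵥ x + (P.A.rad - P.D.lower) *ᵥ |x| := by
    rw [add_mul_diagonal_mulVec, ← hsx, sub_mulVec, add_sub_assoc]
  have hdiff : (P.A.mid + P.A.rad * diagonal s - P.D.lower * diagonal t) *ᵥ (y - x) =
      ((P.A.mid + P.A.rad * diagonal s) *ᵥ y - P.D.lower *ᵥ |y|) -
        (P.A.mid *ᵥ x + (P.A.rad - P.D.lower) *ᵥ |x|) := by
    rw [sub_eq_add_neg, ← Matrix.neg_mul, add_mul_diagonal_mulVec, ← hyx, ← hAx, mulVec_sub, neg_mulVec,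
      mulVec_sub]
    abel
  intro i
  rw [basicRows_mulVec, hdiff]
  exact sub_nonpos.mpr ((hy (B i)).trans (congrFun hx i).ge)

end IntervalAVLP

theorem mainTheorem10 {m n : ℕ} (P : IntervalAVLP m n) (B : Fin n ↪ Fin m)
    (hB : P.IsNondegenerateBStable B) :
    ∃ x : Fin n → ℝ,
      P.basicEq B = {x} ∧
      maximizers P.worstObjective P.lowerBoundFeasible = {x} ∧
      minimizers P.worstObjective (P.basicGe B) = {x} ∧
      maximizers P.worstObjective (P.basicLe B) = {x} ∧
      maximizers P.worstObjective (P.basicEq B) = {x} ∧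
      minimizers P.worstObjective (P.basicEq B) = {x} ∧
      P.worstValue = P.lowerBound ∧
      P.lowerBound = ((P.c.mid ⬝ᵥ x - P.c.rad ⬝ᵥ |x| : ℝ) : EReal) := by
  obtain ⟨x, hx⟩ := hB.basicEq_nonempty
  have hxF := hB.basicEq_subset_lowerBoundFeasible hx
  have hxb : P.basicMap B x = basicPart B P.b.lower := hx
  have hle : ∀ y ∈ P.basicLe B, P.basicMap B y ≤ P.basicMap B x := fun y hy => hxb ▸ hy
  have hge : ∀ y ∈ P.basicGe B, P.basicMap B x ≤ P.basicMap B y := fun y hy => hxb ▸ hy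
  have hEqLe : P.basicEq B ⊆ P.basicLe B := fun y hy => le_of_eq hy
  have hEqGe : P.basicEq B ⊆ P.basicGe B := fun y hy => ge_of_eq hy
  have hmax : ∀ F ⊆ P.basicLe B, x ∈ F → maximizers P.worstObjective F = {x} := by
    intro F hF hxF'
    ext y
    refine ⟨fun hy => hB.eq_of_basicMap_le (hle y (hF hy.1)) (hy.2 x hxF'), ?_⟩
    rintro rfl
    exact ⟨hxF', fun z hz => hB.worstObjective_le (hle z (hF hz))⟩
  have hmin : ∀ F ⊆ P.basicGe B, x ∈ F → minimizers P.worstObjective F = {x} := by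
    intro F hF hxF'
    ext y
    refine ⟨fun hy => (hB.eq_of_basicMap_le (hge y (hF hy.1)) (hy.2 x hxF')).symm, ?_⟩
    rintro rfl
    exact ⟨hxF', fun z hz => hB.worstObjective_le (hge z (hF hz))⟩
  have hlower : P.lowerBound = ((P.worstObjective x : ℝ) : EReal) :=
    le_antisymm (IntervalAVLP.lowerBound_le_worstValue.trans (hB.worstValue_le hx))
      (le_iSup₂_of_le x hxF le_rfl)
  refine ⟨x, ?_, hmax _ IntervalAVLP.lowerBoundFeasible_subset_basicLe hxF,
    hmin _ subset_rfl (hEqGe hx), hmax _ subset_rfl (hEqLe hx), hmax _ hEqLe hx,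
    hmin _ hEqGe hx,
    le_antisymm ((hB.worstValue_le hx).trans hlower.ge) IntervalAVLP.lowerBound_le_worstValue,
    hlower⟩
  ext y
  refine ⟨fun hy => hB.eq_of_basicMap_le (hle y (hEqLe hy))
    (hB.worstObjective_le (hge y (hEqGe hy))), ?_⟩
  rintro rfl
  exact hx
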